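/- **Setting.** Let $W$ be a finite set of potential elements and $f\colon 2^W\to\mathbb{R}_{\ge 0}$ a monotone submodular function. In the problem Max-Card-$k$ in the data stream model, $s$ distinct elements of $W$ arrive one at a time in an arbitrary order; let $V\subseteq W$ be the set of these elements. A (possibly randomized) one-pass data stream algorithm keeps a memory state, which is a string of bits. When an element arrives, the new memory state is computed, possibly with fresh random bits, from the old memory state, the new element, and values of $f$ obtained from an oracle that may be queried only on sets of elements that have already arrived. At the end of the stream the algorithm computes, from its memory state and values of $f$ on subsets of $V$, a set $S\subseteq V$ with $|S|\le k$. The algorithm may depend on $W$, $k$ and $s$, and its computation time and the working space used between two memory states are not restricted. It has approximation guarantee $\rho$ on streams of $s$ elements if for every $f$ and every such stream $\mathbb{E}[f(S)]\ge \rho\cdot\max\{f(T) : T\subseteq V,\ |T|\le k\}$. Its memory usage is the maximum length in bits of the memory state, over all $f$, all streams of $s$ elements, all times and all random choices. **Theorem.** There is an absolute constant $c>0$ such that for every $\varepsilon>0$ there is an integer $k_0=k_0(\varepsilon)$ for which the following holds. Let $k\ge k_0$, let $s\geq 0$ be an integer, and let $W$ be a finite set with $|W|\ge 2s$. Then every data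 stream algorithm for Max-Card-$k$ on streams of $s$ distinct elements of $W$ with approximation guarantee $1/2+\varepsilon$ has memory usage at least $c\,\varepsilon s/k^3$ bits; that is, it must use memory $\Omega(\varepsilon s/k^3)$. -/

import Mathlib

/-- A non-negative monotone submodular set function on (the subsets of) `W`: an objective function
of the cardinality-constrained maximization problem. -/
structure IsSubmodularObjective {W : Type*} [DecidableEq W] (f : Finset W → ℝ) : Prop where
  nonneg : ∀ X, 0 ≤ f X
  mono : ∀ X Y, X ⊆ Y → f X ≤ f Y
  submodular : ∀ X Y, X ⊆ Y → ∀ v, v ∉ Y → f (insert v Y) - f Y ≤ f (insert v X) - f X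

/-- A (randomized, one-pass) data stream algorithm for elements of `W`. Its memory holds a bit
string. The functions `update` and `output` receive the objective function `f` as an oracle (which
of its values may influence them is restricted by `IsMaxCardStreamAlgorithm` below):
`update f m x` is the distribution of the next memory state when the element `x` arrives in the
memory state `m`, and `output f m` is the distribution of the answer at the end of the stream.
Whatever is to be remembered between two arrivals, including random bits and the number of elements
seen, has to be in the memory; the computation in between is not restricted. -/
structure StreamAlgorithm (W : Type*) where
  init : List Bool
  update : (Finset W → ℝ) → List Bool → W → PMF (List Bool)
  output : (Finset W → ℝ) → List Bool → PMF (Finset W)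

namespace StreamAlgorithm

variable {W : Type*}

/-- The distribution of the memory state after the elements of the list `xs` have arrived, in this
order. -/
noncomputable def stateDist (A : StreamAlgorithm W) (f : Finset W → ℝ) (xs : List W) :
    PMF (List Bool) :=
  xs.foldl (fun d x => d.bind fun m => A.update f m x) (PMF.pure A.init)

/-- The distribution of the set that is output after the stream `xs`. -/
noncomputable def outputDist (A : StreamAlgorithm W) (f : Finset W → ℝ) (xs : List W) :
    PMF (Finset W) :=
  (A.stateDist f xs).bind (A.output f)

/-- The expected objective value of the set that is output after the stream `xs`. -/
noncomputable def expectedValue [Fintype W] (A : StreamAlgorithm W) (f : Finset W → ℝ)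
    (xs : List W) : ℝ :=
  ∑ S : Finset W, (A.outputDist f xs S).toReal * f S

/-- `A` is a data stream algorithm for maximizing a non-negative monotone submodular function under
the cardinality constraint `k`, with approximation guarantee `ρ` (in expectation), on streams of `s`
distinct elements of `W`. The first two fields say that the algorithm evaluates `f` only on sets of
elements that have already arrived: in every memory state `m` that can occur, what it does is the
same for all objective functions with the same values on these sets. -/
structure IsMaxCardStreamAlgorithm [Fintype W] [DecidableEq W] (A : StreamAlgorithm W)
    (k s : ℕ) (ρ : ℝ) : Prop where
  update_oracle : ∀ f g : Finset W → ℝ, IsSubmodularObjective f → IsSubmodularObjective g →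
    ∀ (xs : List W) (x : W), (xs ++ [x]).Nodup → xs.length < s →
    (∀ S ⊆ (xs ++ [x]).toFinset, f S = g S) →
    ∀ m ∈ (A.stateDist f xs).support, A.update f m x = A.update g m x
  output_oracle : ∀ f g : Finset W → ℝ, IsSubmodularObjective f → IsSubmodularObjective g →
    ∀ xs : List W, xs.Nodup → xs.length = s →
    (∀ S ⊆ xs.toFinset, f S = g S) →
    ∀ m ∈ (A.stateDist f xs).support, A.output f m = A.output g m
  feasible : ∀ f : Finset W → ℝ, IsSubmodularObjective f →
    ∀ xs : List W, xs.Nodup → xs.length = s →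
    ∀ S ∈ (A.outputDist f xs).support, S ⊆ xs.toFinset ∧ S.card ≤ k
  approx : ∀ f : Finset W → ℝ, IsSubmodularObjective f →
    ∀ xs : List W, xs.Nodup → xs.length = s →
    ∀ T : Finset W, T ⊆ xs.toFinset → T.card ≤ k → ρ * f T ≤ A.expectedValue f xs

/-- On streams of `s` distinct elements the memory of `A` never holds more than `B` bits, for every
objective function, at any time, and for every outcome of the random choices. -/
def UsesMemoryAtMost [DecidableEq W] (A : StreamAlgorithm W) (s B : ℕ) : Prop :=
  ∀ f : Finset W → ℝ, IsSubmodularObjective f → ∀ xs : List W, xs.Nodup → xs.length ≤ s →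
    ∀ m ∈ (A.stateDist f xs).support, m.length ≤ B

end StreamAlgorithm

/-! The hard instance is a chain of levels `0, …, k` with masses `r t - r (t + 1)`, where `r t =
√((k + 1 - t) / (k + 1))`. An ordinary element of level `i` covers the fraction `1 - r (i + 1) / r
i` of every level from `i` on; the hidden element of level `i` covers level `i` completely and
nothing else. Both remove the same mass from what is left at levels `≥ i`, so as long as no later
level has arrived, the oracle cannot tell them apart (`chainObjective_filter_lt`). The `k` hidden
elements cover all but `1 / √(k + 1)`, whereas `k` ordinary ones cover at most `1 / 2 + 1 / √(k +
1)` (`chainObjective_le_of_disjoint`).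

To beat `1 / 2` the algorithm must therefore output a hidden element. A set containing `o` may be
output in a state only if `o` belongs to every stream that can lead to this state, since otherwise
feasibility fails (`outputDist_mem_le`). Each block is one of `2 ^ n` transversals of `n` pairs. A
state that certifies `d` elements is compatible with at most a `2 ^ (-d)` fraction of them, so with
few states some element of some block is rarely certified (`exists_mem_unlikely_certain`). This
element becomes the hidden one, and later blocks cannot make it more certain
(`certainStates_append_le`). A union bound over the `k` hidden elements yields `ratio_mul_le`; the
rest is the choice of `n` and `d`. -/

/-! ### Two-stage distributions and runs of a stream algorithm. -/

/-- The event `T` can be reached only through `C`. The second stage will be either further arrivals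
or the final output. -/
theorem PMF.toOuterMeasure_bind_le {α β : Type*} (p : PMF α) (q : α → PMF β) (C : Set α)
    (T : Set β) (h : ∀ a ∈ p.support, ∀ b ∈ (q a).support, b ∈ T → a ∈ C) :
    (p.bind q).toOuterMeasure T ≤ p.toOuterMeasure C := by
  rw [PMF.toOuterMeasure_bind_apply, PMF.toOuterMeasure_apply]
  refine ENNReal.tsum_le_tsum fun a => ?_
  by_cases ha : a ∈ p.support
  · by_cases hC : a ∈ C
    · rw [Set.indicator_of_mem hC]
      refine mul_le_of_le_one_right' ?_
      calc _ ≤ (q a).toOuterMeasure Set.univ := (q a).toOuterMeasure.mono (Set.subset_univ _)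
        _ = 1 := ((q a).toOuterMeasure_apply_eq_one_iff _).2 (Set.subset_univ _)
    · have : (q a).toOuterMeasure T = 0 := by
        rw [PMF.toOuterMeasure_apply_eq_zero_iff, Set.disjoint_left]
        exact fun b hb hT => hC (h a ha b hb hT)
      simp [this]
  · simp [(PMF.apply_eq_zero_iff p a).2 ha]

theorem PMF.bind_congr_support {α β : Type*} (p : PMF α) (q q' : α → PMF β)
    (h : ∀ a ∈ p.support, q a = q' a) : p.bind q = p.bind q' := by
  ext b
  rw [PMF.bind_apply, PMF.bind_apply]
  refine tsum_congr fun a => ?_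
  by_cases ha : a ∈ p.support
  · rw [h a ha]
  · simp [(PMF.apply_eq_zero_iff p a).2 ha]

namespace StreamAlgorithm

variable {W : Type*}

theorem stateDist_concat (A : StreamAlgorithm W) (f : Finset W → ℝ) (xs : List W) (x : W) :
    A.stateDist f (xs ++ [x]) = (A.stateDist f xs).bind fun m => A.update f m x := by
  simp [stateDist]

/-- The distribution of the memory state after the arrival of `zs` in memory state `m`. -/
noncomputable def runFrom (A : StreamAlgorithm W) (f : Finset W → ℝ) (zs : List W)
    (m : List Bool) : PMF (List Bool) :=
  zs.foldl (fun d x => d.bind fun m => A.update f m x) (PMF.pure m)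

theorem stateDist_append (A : StreamAlgorithm W) (f : Finset W → ℝ) (xs zs : List W) :
    A.stateDist f (xs ++ zs) = (A.stateDist f xs).bind (A.runFrom f zs) := by
  induction zs using List.reverseRecOn with
  | nil =>
    have : A.runFrom f [] = PMF.pure := rfl
    rw [this, PMF.bind_pure, List.append_nil]
  | append_singleton zs z ih =>
    rw [← List.append_assoc, stateDist_concat, ih, PMF.bind_bind]
    congr 1
    funext m
    simp [runFrom]

theorem IsMaxCardStreamAlgorithm.stateDist_congr [Fintype W] [DecidableEq W]
    {A : StreamAlgorithm W} {k s : ℕ} {ρ : ℝ} (hA : A.IsMaxCardStreamAlgorithm k s ρ)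
    {f g : Finset W → ℝ} (hf : IsSubmodularObjective f) (hg : IsSubmodularObjective g)
    (xs : List W) (hxs : xs.Nodup) (hs : xs.length ≤ s)
    (hfg : ∀ S ⊆ xs.toFinset, f S = g S) : A.stateDist f xs = A.stateDist g xs := by
  induction xs using List.reverseRecOn with
  | nil => rfl
  | append_singleton xs x ih =>
    have hlen : xs.length + 1 ≤ s := by simpa using hs
    have ih' := ih (List.Nodup.of_append_left hxs) (by omega) fun S hS => hfg S
      (hS.trans (by rw [List.toFinset_append]; exact Finset.subset_union_left))
    rw [stateDist_concat, stateDist_concat, ← ih']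
    exact PMF.bind_congr_support _ _ _ fun m hm =>
      hA.update_oracle f g hf hg xs x hxs (by omega) hfg m hm

end StreamAlgorithm

/-! ### Few bits certify few elements. -/

/-- A random message of few bits about a random set `V x` reveals few elements of this set with
certainty: for some `x`, some element of `V x` is unlikely to be certain after the message. -/
theorem exists_mem_unlikely_certain {X W M : Type*} [Fintype X] [Nonempty X] [Fintype W]
    [DecidableEq W] {n : ℕ} (hn : 0 < n) (V : X → Finset W) (hV : ∀ x, (V x).card = n)
    (hsub : ∀ C : Finset W, ((Finset.univ.filter fun x => C ⊆ V x).card : ℝ) * 2 ^ C.card ≤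
      Fintype.card X)
    (P : X → PMF M) (𝓜 : Finset M) (hP : ∀ x, ∀ m ∈ (P x).support, m ∈ 𝓜) {d : ℕ} :
    ∃ x, ∃ o ∈ V x, (P x).toOuterMeasure {m | ∀ x', m ∈ (P x').support → o ∈ V x'} ≤
      ENNReal.ofReal (d / n + 𝓜.card / 2 ^ d) := by
  classical
  set C : M → Finset W := fun m => Finset.univ.filter fun o => ∀ x', m ∈ (P x').support → o ∈ V x'
    with hC
  set p : X → M → ℝ := fun x m => (P x m).toReal with hp
  have hp0 : ∀ x m, 0 ≤ p x m := fun x m => ENNReal.toReal_nonneg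
  have hp1 : ∀ x m, p x m ≤ 1 := fun x m =>
    ENNReal.toReal_le_of_le_ofReal zero_le_one (by simpa using (P x).coe_le_one m)
  have hpsum : ∀ x, ∑ m ∈ 𝓜, p x m = 1 := by
    intro x
    rw [← ENNReal.toReal_sum fun m _ => (P x).apply_ne_top m, ← PMF.toOuterMeasure_apply_finset,
      ((P x).toOuterMeasure_apply_eq_one_iff _).2 (fun m hm => hP x m hm), ENNReal.toReal_one]
  have hnR : (0 : ℝ) < n := by exact_mod_cast hn
  by_contra! hcon
  have hcon' : ∀ x, ∀ o ∈ V x, (d / n + 𝓜.card / 2 ^ d : ℝ) <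
      ∑ m ∈ 𝓜, if o ∈ C m then p x m else 0 := by
    intro x o ho
    have h := hcon x o ho
    have heq : (P x).toOuterMeasure {m | ∀ x', m ∈ (P x').support → o ∈ V x'} =
        ENNReal.ofReal (∑ m ∈ 𝓜, if o ∈ C m then p x m else 0) := by
      rw [← Finset.sum_filter, ENNReal.ofReal_sum_of_nonneg fun m _ => hp0 x m]
      simp only [hp, ENNReal.ofReal_toReal ((P x).apply_ne_top _)]
      rw [← PMF.toOuterMeasure_apply_finset]
      refine (P x).toOuterMeasure_apply_eq_of_inter_support_eq ?_
      ext m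
      simp only [Set.mem_inter_iff, Set.mem_ofPred_eq, Finset.coe_filter, hC, Finset.mem_filter,
        Finset.mem_univ, true_and]
      constructor
      · rintro ⟨h1, h2⟩
        exact ⟨⟨hP x m h2, h1⟩, h2⟩
      · rintro ⟨⟨_, h1⟩, h2⟩
        exact ⟨h1, h2⟩
    rw [heq] at h
    exact lt_of_not_ge fun h' => absurd h (not_lt.2 (ENNReal.ofReal_le_ofReal h'))
  -- The expected number of certified elements, summed over all `x`, is estimated from both sides;
  -- the two bounds turn out equal, against the strict inequality here.
  have hlow : (Fintype.card X : ℝ) * (n * (d / n + 𝓜.card / 2 ^ d)) <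
      ∑ x, ∑ o ∈ V x, ∑ m ∈ 𝓜, if o ∈ C m then p x m else 0 := by
    have : ∀ x ∈ (Finset.univ : Finset X), (n * (d / n + 𝓜.card / 2 ^ d) : ℝ) <
        ∑ o ∈ V x, ∑ m ∈ 𝓜, if o ∈ C m then p x m else 0 := by
      intro x _
      have hne : (V x).Nonempty := Finset.card_pos.1 (by rw [hV]; exact hn)
      have := Finset.sum_lt_sum_of_nonempty hne (hcon' x)
      rwa [Finset.sum_const, hV, nsmul_eq_mul] at this
    have := Finset.sum_lt_sum_of_nonempty Finset.univ_nonempty this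
    rwa [Finset.sum_const, Finset.card_univ, nsmul_eq_mul] at this
  -- Messages certifying fewer than `d` elements cost at most `d` on average. Any other possible
  -- message is charged `n`, with its probability bounded by `1`; by `hsub` it is compatible with
  -- few `x`.
  have hup : ∑ x, ∑ o ∈ V x, ∑ m ∈ 𝓜, (if o ∈ C m then p x m else 0) ≤
      ∑ x, (d + n * ∑ m ∈ 𝓜, if d ≤ (C m).card ∧ C m ⊆ V x then (1 : ℝ) else 0) := by
    refine Finset.sum_le_sum fun x _ => ?_
    rw [Finset.sum_comm]
    have hm : ∀ m ∈ 𝓜, ∑ o ∈ V x, (if o ∈ C m then p x m else 0) ≤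
        p x m * d + n * if d ≤ (C m).card ∧ C m ⊆ V x then (1 : ℝ) else 0 := by
      intro m _
      by_cases hmx : m ∈ (P x).support
      · have hCV : C m ⊆ V x := fun o ho => (Finset.mem_filter.1 ho).2 x hmx
        rw [← Finset.sum_filter, Finset.filter_mem_eq_inter, Finset.inter_eq_right.2 hCV,
          Finset.sum_const, nsmul_eq_mul]
        by_cases hd : d ≤ (C m).card
        · rw [if_pos ⟨hd, hCV⟩]
          have h1 : ((C m).card : ℝ) ≤ n := by
            exact_mod_cast (Finset.card_le_card hCV).trans (hV x).le
          have := hp0 x m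
          have := hp1 x m
          have : 0 ≤ p x m * d := by positivity
          have : (0 : ℝ) ≤ (C m).card := by positivity
          nlinarith
        · rw [if_neg fun h => hd h.1, mul_zero, add_zero, mul_comm]
          have h1 : ((C m).card : ℝ) ≤ d := by exact_mod_cast (not_le.1 hd).le
          exact mul_le_mul_of_nonneg_left h1 (hp0 x m)
      · have : p x m = 0 := by simp [hp, (PMF.apply_eq_zero_iff (P x) m).2 hmx]
        rw [this]
        simp only [ite_self, Finset.sum_const_zero, zero_mul, zero_add]
        positivity
    refine (Finset.sum_le_sum hm).trans (le_of_eq ?_)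
    rw [Finset.sum_add_distrib, ← Finset.sum_mul, hpsum, one_mul, ← Finset.mul_sum]
  have hcount : ∑ x, ∑ m ∈ 𝓜, (if d ≤ (C m).card ∧ C m ⊆ V x then (1 : ℝ) else 0) ≤
      𝓜.card * (Fintype.card X / 2 ^ d) := by
    rw [Finset.sum_comm, ← nsmul_eq_mul]
    refine Finset.sum_le_card_nsmul _ _ _ fun m _ => ?_
    by_cases hd : d ≤ (C m).card
    · simp only [hd, true_and, Finset.sum_boole]
      rw [le_div_iff₀ (by positivity)]
      refine le_trans ?_ (hsub (C m))
      gcongr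
      norm_num
    · simp only [hd, false_and, if_false, Finset.sum_const_zero]
      positivity
  rw [Finset.sum_add_distrib, ← Finset.mul_sum, Finset.sum_const, Finset.card_univ,
    nsmul_eq_mul] at hup
  have h1 := hlow.trans_le (hup.trans (add_le_add_right
    (mul_le_mul_of_nonneg_left hcount hnR.le) _))
  refine absurd h1 (not_lt.2 (le_of_eq ?_))
  field_simp

/-! ### The square root mass profile and its Riemann sum. -/

/-- The mass that is left to the levels `≥ i` of the chain instance with `k` levels. -/
noncomputable def remainingMass (k i : ℕ) : ℝ := √(((k + 1 : ℝ) - i) / (k + 1))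

theorem remainingMass_nonneg (k i : ℕ) : 0 ≤ remainingMass k i := Real.sqrt_nonneg _

theorem remainingMass_sq {k i : ℕ} (h : i ≤ k + 1) :
    remainingMass k i ^ 2 = ((k + 1 : ℝ) - i) / (k + 1) := by
  have : (i : ℝ) ≤ k + 1 := by exact_mod_cast h
  exact Real.sq_sqrt (div_nonneg (by linarith) (by positivity))

theorem remainingMass_antitone (k : ℕ) : Antitone (remainingMass k) := by
  intro i j h
  have : (i : ℝ) ≤ j := by exact_mod_cast h
  unfold remainingMass
  gcongr

theorem remainingMass_pos {k i : ℕ} (h : i ≤ k) : 0 < remainingMass k i := by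
  have : (i : ℝ) ≤ k := by exact_mod_cast h
  exact Real.sqrt_pos.2 (div_pos (by linarith) (by positivity))

@[simp] theorem remainingMass_zero (k : ℕ) : remainingMass k 0 = 1 := by
  have : (k + 1 : ℝ) ≠ 0 := by positivity
  simp [remainingMass, div_self this]

@[simp] theorem remainingMass_succ_self (k : ℕ) : remainingMass k (k + 1) = 0 := by
  simp [remainingMass]

theorem remainingMass_self (k : ℕ) : remainingMass k k = 1 / √(k + 1 : ℝ) := by
  simp [remainingMass]

theorem remainingMass_le_one (k i : ℕ) : remainingMass k i ≤ 1 := by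
  simpa using remainingMass_antitone k (Nat.zero_le i)

/-- The mass of one level is at most `1 / √(k + 1)`. -/
theorem remainingMass_sub_le {k t : ℕ} (h : t ≤ k) :
    remainingMass k t - remainingMass k (t + 1) ≤ 1 / √(k + 1 : ℝ) := by
  have h1 := remainingMass_sq (k := k) (i := t) (by omega)
  have h2 := remainingMass_sq (k := k) (i := t + 1) (by omega)
  have h3 : 1 / √(k + 1 : ℝ) ≤ remainingMass k t :=
    remainingMass_self k ▸ remainingMass_antitone k h
  have h0 : 0 < 1 / √(k + 1 : ℝ) := by positivity
  have h4 := remainingMass_nonneg k (t + 1)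
  have h5 : (1 / √(k + 1 : ℝ)) ^ 2 = 1 / (k + 1) := by
    rw [div_pow, Real.sq_sqrt (by positivity), one_pow]
  have h6 : remainingMass k t ^ 2 - remainingMass k (t + 1) ^ 2 = (1 / √(k + 1 : ℝ)) ^ 2 := by
    rw [h1, h2, h5]; push_cast; field_simp; ring
  -- With `δ = 1 / √(k + 1)`, the difference of squares is `δ ^ 2` and the sum of the two masses is
  -- at least `δ`.
  by_contra! hc
  nlinarith

/-- From `(a - b) * b ≤ (a ^ 2 - b ^ 2) / 2`. The squares form an arithmetic progression, so the
bound is the same for all levels; the square root profile is made for this. -/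
theorem remainingMass_mul_sub_le {k t : ℕ} (h : t ≤ k) :
    (remainingMass k t - remainingMass k (t + 1)) * remainingMass k (t + 1) ≤
      1 / (2 * (k + 1)) := by
  have h1 := remainingMass_sq (k := k) (i := t) (by omega)
  have h2 := remainingMass_sq (k := k) (i := t + 1) (by omega)
  have h6 : remainingMass k t ^ 2 - remainingMass k (t + 1) ^ 2 = 1 / (k + 1) := by
    rw [h1, h2]; push_cast; field_simp; ring
  have : (1 : ℝ) / (2 * (k + 1)) = (1 / (k + 1)) / 2 := by field_simp
  rw [this, ← h6]
  nlinarith [sq_nonneg (remainingMass k t - remainingMass k (t + 1))]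

theorem sum_remainingMass_sub (k i : ℕ) (h : i ≤ k + 1) :
    ∑ t ∈ Finset.Ico i (k + 1), (remainingMass k t - remainingMass k (t + 1)) =
      remainingMass k i := by
  have := Finset.sum_Ico_sub (fun t => - remainingMass k t) h
  simp only [remainingMass_succ_self] at this
  rw [← sub_eq_zero, ← sub_eq_zero.2 this]
  simp only [neg_sub_neg]
  ring

/-- The logarithmic decay of the remaining mass at level `i`. -/
theorem log_remainingMass_div_le {k i : ℕ} (h : i < k) :
    Real.log (remainingMass k i / remainingMass k (i + 1)) ≤ 1 / (2 * (k - i)) := by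
  have hi : (i : ℝ) + 1 ≤ k := by exact_mod_cast h
  have h1 := remainingMass_sq (k := k) (i := i) (by omega)
  have h2 := remainingMass_sq (k := k) (i := i + 1) (by omega)
  have p1 := remainingMass_pos (k := k) (i := i) (by omega)
  have p2 := remainingMass_pos (k := k) (i := i + 1) (by omega)
  have h3 : (remainingMass k i / remainingMass k (i + 1)) ^ 2 = 1 + 1 / (k - i) := by
    have h' : (k : ℝ) - i ≠ 0 := by linarith
    have h'' : (k : ℝ) + 1 - (i + 1) ≠ 0 := by linarith
    have h''' : (k : ℝ) + 1 ≠ 0 := by positivity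
    rw [div_pow, h1, h2]; push_cast; field_simp; ring
  have h4 := Real.log_le_sub_one_of_pos (show 0 < (remainingMass k i / remainingMass k (i + 1)) ^ 2
    by positivity)
  rw [Real.log_pow, h3] at h4
  have : (1 : ℝ) / (2 * (k - i)) = (1 / (k - i)) / 2 := by
    have h' : (k : ℝ) - i ≠ 0 := by linarith
    field_simp
  rw [this]
  push_cast at h4
  linarith

/-- The form `x * (x * log x)` makes the continuity of the antiderivative at `0` evident, which the
mean value theorem needs on intervals starting at `0`. -/
theorem hasDerivAt_sq_mul_log {x : ℝ} (hx : 0 < x) :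
    HasDerivAt (fun x : ℝ => x ^ 2 * (3 / 4) - x * (x * Real.log x) / 2)
      (x * (1 - Real.log x)) x := by
  have h1 := (hasDerivAt_pow 2 x).mul_const (3 / 4 : ℝ)
  have h2 := (((hasDerivAt_id x).mul ((hasDerivAt_id x).mul
    (Real.hasDerivAt_log hx.ne'))).div_const (2 : ℝ))
  refine (h1.sub h2).congr_deriv ?_
  simp
  field_simp
  ring

theorem mul_one_sub_log_monotoneOn :
    MonotoneOn (fun x : ℝ => x * (1 - Real.log x)) (Set.Icc 0 1) := by
  intro x hx y hy hxy
  rcases hx.1.eq_or_lt with h0 | h0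
  · subst h0
    have : Real.log y ≤ 0 := Real.log_nonpos hy.1 hy.2
    simp only [zero_mul]
    exact mul_nonneg hy.1 (by linarith)
  have hy0 : 0 < y := h0.trans_le hxy
  have h1 := Real.log_le_sub_one_of_pos (div_pos hy0 h0)
  rw [Real.log_div hy0.ne' h0.ne'] at h1
  have h2 : Real.log y ≤ 0 := Real.log_nonpos hy.1 hy.2
  have h3 : x * (Real.log y - Real.log x) ≤ y - x := by
    calc _ ≤ x * (y / x - 1) := by gcongr
      _ = _ := by field_simp
  change x * (1 - Real.log x) ≤ y * (1 - Real.log y)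
  nlinarith

theorem sq_mul_log_sub_le {x y : ℝ} (hy : 0 ≤ y) (hyx : y ≤ x) (hx : x ≤ 1) :
    (x ^ 2 * (3 / 4) - x * (x * Real.log x) / 2) - (y ^ 2 * (3 / 4) - y * (y * Real.log y) / 2) ≤
      (x - y) * (x * (1 - Real.log x)) := by
  rcases hyx.eq_or_lt with h | h
  · simp [h]
  obtain ⟨c, hc, hc'⟩ := exists_hasDerivAt_eq_slope
    (fun x : ℝ => x ^ 2 * (3 / 4) - x * (x * Real.log x) / 2)
    (fun x => x * (1 - Real.log x)) h
    (by have := Real.continuous_mul_log; fun_prop)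
    (fun z hz => hasDerivAt_sq_mul_log (hy.trans_lt hz.1))
  have hm := mul_one_sub_log_monotoneOn ⟨hy.trans hc.1.le, hc.2.le.trans hx⟩ ⟨hy.trans hyx, hx⟩
    hc.2.le
  simp only at hm hc'
  rw [hc', div_le_iff₀ (by linarith)] at hm
  linarith

/-- A lower Riemann sum of `∫₀¹ x (1 - log x) dx = 3 / 4`. -/
theorem sum_remainingMass_mul_log_ge (k : ℕ) :
    3 / 4 - 1 / √(k + 1 : ℝ) ≤
      ∑ t ∈ Finset.range k, (remainingMass k t - remainingMass k (t + 1)) *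
        (remainingMass k (t + 1) * (1 - Real.log (remainingMass k (t + 1)))) := by
  set r := remainingMass k with hr
  -- The integral over one cell is at most the upper rectangle. Upper and lower rectangle differ by
  -- at most the mesh `1 / √(k + 1)` times the increment of the integrand, and these increments
  -- telescope to `1`.
  have key : ∀ t ∈ Finset.range (k + 1),
      (r t ^ 2 * (3 / 4) - r t * (r t * Real.log (r t)) / 2) -
        (r (t + 1) ^ 2 * (3 / 4) - r (t + 1) * (r (t + 1) * Real.log (r (t + 1))) / 2) ≤
      (r t - r (t + 1)) * (r (t + 1) * (1 - Real.log (r (t + 1)))) + 1 / √(k + 1 : ℝ) *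
        (r t * (1 - Real.log (r t)) - r (t + 1) * (1 - Real.log (r (t + 1)))) := by
    intro t ht
    have ht : t ≤ k := by simpa [Nat.lt_succ_iff] using ht
    have hm := mul_one_sub_log_monotoneOn ⟨remainingMass_nonneg k (t + 1),
      remainingMass_le_one k (t + 1)⟩ ⟨remainingMass_nonneg k t, remainingMass_le_one k t⟩
      (remainingMass_antitone k t.le_succ)
    have h1 := sq_mul_log_sub_le (remainingMass_nonneg k (t + 1))
      (remainingMass_antitone k t.le_succ) (remainingMass_le_one k t)
    have h2 := mul_le_mul_of_nonneg_right (remainingMass_sub_le ht) (sub_nonneg.2 hm)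
    simp only [← hr] at h1 h2
    linarith
  have h := Finset.sum_le_sum key
  rw [Finset.sum_add_distrib, ← Finset.mul_sum, Finset.sum_range_sub'
    (fun t => r t ^ 2 * (3 / 4) - r t * (r t * Real.log (r t)) / 2), Finset.sum_range_sub'
    (fun t => r t * (1 - Real.log (r t))), Finset.sum_range_succ] at h
  simp only [hr, remainingMass_zero, remainingMass_succ_self, Real.log_one] at h ⊢
  norm_num at h ⊢
  linarith

/-! ### The objective functions with hidden elements. -/

/-- Expected weighted coverage when `x` independently misses `t` with probability `w t x`. The
marginal of `v` at `t` is `b t * (1 - w t v)` times the probability that `t` is still uncovered,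
which shrinks as the set grows. -/
theorem Finset.isSubmodularObjective_coverage {ι W : Type*} [DecidableEq W] (T : Finset ι)
    (b : ι → ℝ) (w : ι → W → ℝ) (hb : ∀ t ∈ T, 0 ≤ b t) (h0 : ∀ t ∈ T, ∀ x, 0 ≤ w t x)
    (h1 : ∀ t ∈ T, ∀ x, w t x ≤ 1) :
    IsSubmodularObjective fun S : Finset W => ∑ t ∈ T, b t * (1 - ∏ x ∈ S, w t x) := by
  have anti : ∀ t ∈ T, ∀ X Y : Finset W, X ⊆ Y → ∏ x ∈ Y, w t x ≤ ∏ x ∈ X, w t x :=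
    fun t ht X Y h => Finset.prod_le_prod_of_subset_of_le_one h (fun x _ => h0 t ht x)
      (fun x _ _ => h1 t ht x)
  refine ⟨fun X => ?_, fun X Y h => ?_, fun X Y h v hv => ?_⟩
  · refine Finset.sum_nonneg fun t ht => mul_nonneg (hb t ht) ?_
    have := anti t ht ∅ X (by simp)
    simp only [Finset.prod_empty] at this
    linarith
  · refine Finset.sum_le_sum fun t ht => mul_le_mul_of_nonneg_left ?_ (hb t ht)
    linarith [anti t ht X Y h]
  · rw [← Finset.sum_sub_distrib, ← Finset.sum_sub_distrib]
    refine Finset.sum_le_sum fun t ht => ?_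
    rw [Finset.prod_insert hv, Finset.prod_insert fun h' => hv (h h')]
    have := mul_nonneg (hb t ht) (mul_nonneg (sub_nonneg.2 (h1 t ht v))
      (sub_nonneg.2 (anti t ht X Y h)))
    nlinarith

/-- The fraction of level `t` which is not covered by the element `x`; the elements of `O` are the
hidden ones. -/
noncomputable def avoidance {W : Type*} [DecidableEq W] (k : ℕ) (lev : W → ℕ) (O : Finset W)
    (t : ℕ) (x : W) : ℝ :=
  if x ∈ O then (if lev x = t then 0 else 1)
  else if lev x ≤ t then remainingMass k (lev x + 1) / remainingMass k (lev x) else 1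

/-- The objective function with hidden elements `O`. A hidden element covers exactly its own level,
any other element covers, independently, the same fraction of its own and of all later levels. -/
noncomputable def chainObjective {W : Type*} [DecidableEq W] (k : ℕ) (lev : W → ℕ) (O : Finset W)
    (S : Finset W) : ℝ :=
  ∑ t ∈ Finset.range (k + 1), (remainingMass k t - remainingMass k (t + 1)) *
    (1 - ∏ x ∈ S, avoidance k lev O t x)

section
variable {W : Type*} [DecidableEq W] {k : ℕ} {lev : W → ℕ} {O : Finset W}

theorem avoidance_nonneg (t : ℕ) (x : W) : 0 ≤ avoidance k lev O t x := by
  unfold avoidance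
  split_ifs
  · exact le_rfl
  · exact zero_le_one
  · exact div_nonneg (remainingMass_nonneg _ _) (remainingMass_nonneg _ _)
  · exact zero_le_one

theorem avoidance_le_one (t : ℕ) (x : W) : avoidance k lev O t x ≤ 1 := by
  unfold avoidance
  split_ifs
  · exact zero_le_one
  · exact le_rfl
  · exact div_le_one_of_le₀ (remainingMass_antitone k (Nat.le_succ _)) (remainingMass_nonneg _ _)
  · exact le_rfl

theorem isSubmodularObjective_chainObjective :
    IsSubmodularObjective (chainObjective k lev O) :=
  Finset.isSubmodularObjective_coverage _ _ _
    (fun t _ => sub_nonneg.2 (remainingMass_antitone k t.le_succ))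
    (fun t _ x => avoidance_nonneg t x) (fun t _ x => avoidance_le_one t x)

theorem chainObjective_eq (S : Finset W) : chainObjective k lev O S =
    1 - ∑ t ∈ Finset.range (k + 1), (remainingMass k t - remainingMass k (t + 1)) *
      ∏ x ∈ S, avoidance k lev O t x := by
  have := sum_remainingMass_sub k 0 (Nat.zero_le _)
  rw [← Finset.range_eq_Ico, remainingMass_zero] at this
  simp only [chainObjective, mul_sub, mul_one]
  rw [Finset.sum_sub_distrib, this]

theorem chainObjective_le_one (S : Finset W) : chainObjective k lev O S ≤ 1 := by
  rw [chainObjective_eq, sub_le_self_iff]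
  exact Finset.sum_nonneg fun t _ => mul_nonneg
    (sub_nonneg.2 (remainingMass_antitone k t.le_succ))
    (Finset.prod_nonneg fun x _ => avoidance_nonneg t x)

/-- On the elements of the levels up to `i` the hidden element of level `i` looks like any other
element of this level. -/
theorem chainObjective_filter_lt (hO : Set.InjOn lev O) (hlev : ∀ x ∈ O, lev x < k) {i : ℕ}
    (hi : i < k) {S : Finset W} (hS : ∀ x ∈ S, lev x ≤ i ∨ lev x = k + 1) :
    chainObjective k lev (O.filter fun x => lev x < i) S = chainObjective k lev O S := by
  set O' := O.filter fun x => lev x < i with hO'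
  rw [chainObjective_eq, chainObjective_eq]
  congr 1
  by_cases hex : ∃ o ∈ S, o ∈ O ∧ lev o = i
  · obtain ⟨o, hoS, hoO, hoi⟩ := hex
    have hoO' : o ∉ O' := by simp [hO', hoi]
    have hsame : ∀ x ∈ S.erase o, (x ∈ O' ↔ x ∈ O) := by
      intro x hx
      obtain ⟨hxo, hxS⟩ := Finset.mem_erase.1 hx
      simp only [hO', Finset.mem_filter, and_iff_left_iff_imp]
      intro hxO
      rcases hS x hxS with h | h
      · refine lt_of_le_of_ne h fun h' => hxo (hO hxO hoO (h'.trans hoi.symm))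
      · have := hlev x hxO; omega
    have hprod : ∀ t, ∏ x ∈ S.erase o, avoidance k lev O' t x =
        ∏ x ∈ S.erase o, avoidance k lev O t x := fun t =>
      Finset.prod_congr rfl fun x hx => by simp only [avoidance, hsame x hx]
    -- The other elements of `S` act equally on all levels `≥ i`, so only the total mass that `o`
    -- leaves there matters: `r i * (r (i + 1) / r i)` if it is ordinary, the mass `r (i + 1)` of
    -- the levels `> i` if it is hidden.
    have hconst : ∀ t ∈ Finset.Ico i (k + 1), ∏ x ∈ S.erase o, avoidance k lev O t x =
        ∏ x ∈ S.erase o, avoidance k lev O k x := by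
      intro t ht
      obtain ⟨ht1, ht2⟩ := Finset.mem_Ico.1 ht
      refine Finset.prod_congr rfl fun x hx => ?_
      obtain ⟨hxo, hxS⟩ := Finset.mem_erase.1 hx
      unfold avoidance
      by_cases hxO : x ∈ O
      · have h1 := hlev x hxO
        have h2 : lev x < i := by
          have := (hsame x hx).2 hxO
          simp only [hO', Finset.mem_filter] at this
          exact this.2
        rw [if_pos hxO, if_pos hxO, if_neg (by omega), if_neg (by omega)]
      · rw [if_neg hxO, if_neg hxO]
        rcases hS x hxS with h | h
        · rw [if_pos (by omega), if_pos (by omega)]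
        · rw [if_neg (by omega), if_neg (by omega)]
    simp only [← Finset.mul_prod_erase S _ hoS, hprod]
    rw [← Finset.sum_range_add_sum_Ico _ (show i ≤ k + 1 by omega),
      ← Finset.sum_range_add_sum_Ico _ (show i ≤ k + 1 by omega)]
    congr 1
    · refine Finset.sum_congr rfl fun t ht => ?_
      have ht := Finset.mem_range.1 ht
      simp only [avoidance, hoO, hoO', if_true, if_false]
      rw [if_neg (by omega), if_neg (by omega)]
    · have h1 : ∀ t ∈ Finset.Ico i (k + 1),
          (remainingMass k t - remainingMass k (t + 1)) * (avoidance k lev O' t o *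
            ∏ x ∈ S.erase o, avoidance k lev O t x) =
          (remainingMass k t - remainingMass k (t + 1)) *
            (remainingMass k (i + 1) / remainingMass k i *
              ∏ x ∈ S.erase o, avoidance k lev O k x) := by
        intro t ht
        rw [hconst t ht]
        have ht := (Finset.mem_Ico.1 ht).1
        simp only [avoidance, hoO', if_false, hoi, ht, if_true]
      rw [Finset.sum_congr rfl h1, ← Finset.sum_mul, sum_remainingMass_sub k i (by omega),
        Finset.sum_eq_sum_Ico_succ_bot (by omega)]
      have h2 : ∀ t ∈ Finset.Ico (i + 1) (k + 1),
          (remainingMass k t - remainingMass k (t + 1)) * (avoidance k lev O t o *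
            ∏ x ∈ S.erase o, avoidance k lev O t x) =
          (remainingMass k t - remainingMass k (t + 1)) *
            ∏ x ∈ S.erase o, avoidance k lev O k x := by
        intro t ht
        have ht' := Finset.mem_Ico.1 ht
        rw [hconst t (Finset.mem_Ico.2 ⟨by omega, ht'.2⟩)]
        simp only [avoidance, hoO, if_true]
        rw [if_neg (by omega), one_mul]
      rw [Finset.sum_congr rfl h2, ← Finset.sum_mul, sum_remainingMass_sub k (i + 1) (by omega)]
      have h3 : avoidance k lev O i o = 0 := by simp [avoidance, hoO, hoi]
      have h4 := (remainingMass_pos (k := k) (i := i) (by omega)).ne'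
      rw [h3]
      field_simp
      ring
  · refine Finset.sum_congr rfl fun t _ => congrArg _ (Finset.prod_congr rfl fun x hx => ?_)
    have : x ∈ O' ↔ x ∈ O := by
      simp only [hO', Finset.mem_filter, and_iff_left_iff_imp]
      intro hxO
      rcases hS x hx with h | h
      · exact lt_of_le_of_ne h fun h' => hex ⟨x, hx, hxO, h'⟩
      · have := hlev x hxO; omega
    simp only [avoidance, this]

/-- The hidden elements cover all levels but the last one. -/
theorem chainObjective_hidden (hlev : ∀ t < k, ∃ x ∈ O, lev x = t) (hlt : ∀ x ∈ O, lev x < k) :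
    chainObjective k lev O O = 1 - 1 / √(k + 1 : ℝ) := by
  rw [chainObjective_eq, Finset.sum_range_succ, Finset.sum_eq_zero, zero_add,
    Finset.prod_eq_one, mul_one, remainingMass_succ_self, sub_zero, remainingMass_self]
  · intro x hx
    have := hlt x hx
    rw [avoidance, if_pos hx, if_neg (by omega)]
  · intro t ht
    obtain ⟨x, hx, hxt⟩ := hlev t (Finset.mem_range.1 ht)
    rw [Finset.prod_eq_zero hx (by rw [avoidance, if_pos hx, if_pos hxt]), mul_zero]

/-- The tangent of `exp` at `log (r (t + 1))`, the exponent obtained from one ordinary element on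
each level `≤ t`. This makes the bound linear in the chosen elements. -/
theorem prod_remainingMass_div_ge {W : Type*} {k : ℕ} {lev : W → ℕ} {t : ℕ} (ht : t < k) (S : Finset W) :
    remainingMass k (t + 1) * (1 - Real.log (remainingMass k (t + 1)) -
      ∑ x ∈ S with lev x ≤ t, Real.log (remainingMass k (lev x) / remainingMass k (lev x + 1))) ≤
    ∏ x ∈ S with lev x ≤ t, remainingMass k (lev x + 1) / remainingMass k (lev x) := by
  have hr := remainingMass_pos (k := k) (i := t + 1) (by omega)
  set Λ := ∑ x ∈ S with lev x ≤ t, Real.log (remainingMass k (lev x) / remainingMass k (lev x + 1))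
  have h1 : ∏ x ∈ S with lev x ≤ t, remainingMass k (lev x + 1) / remainingMass k (lev x) =
      Real.exp (-Λ) := by
    rw [← Finset.sum_neg_distrib, Real.exp_sum]
    refine Finset.prod_congr rfl fun x hx => ?_
    have hx := (Finset.mem_filter.1 hx).2
    have p1 := remainingMass_pos (k := k) (i := lev x) (by omega)
    have p2 := remainingMass_pos (k := k) (i := lev x + 1) (by omega)
    rw [← Real.log_inv, inv_div, Real.exp_log (div_pos p2 p1)]
  have h2 : Real.exp (-Λ) = remainingMass k (t + 1) *
      Real.exp (-Λ - Real.log (remainingMass k (t + 1))) := by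
    rw [Real.exp_sub, Real.exp_log hr]
    field_simp
  rw [h1, h2]
  refine mul_le_mul_of_nonneg_left ?_ hr.le
  linarith [Real.add_one_le_exp (-Λ - Real.log (remainingMass k (t + 1)))]

/-- Without hidden elements, `k` elements cover essentially at most one half. -/
theorem chainObjective_le_of_disjoint {S : Finset W} (hS : S.card ≤ k) (hd : Disjoint S O) :
    chainObjective k lev O S ≤ 1 / 2 + 1 / √(k + 1 : ℝ) := by
  have hprod : ∀ t, ∏ x ∈ S, avoidance k lev O t x =
      ∏ x ∈ S with lev x ≤ t, remainingMass k (lev x + 1) / remainingMass k (lev x) := by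
    intro t
    rw [Finset.prod_filter]
    refine Finset.prod_congr rfl fun x hx => ?_
    rw [avoidance, if_neg (Finset.disjoint_left.1 hd hx)]
  set b : ℕ → ℝ := fun t => remainingMass k t - remainingMass k (t + 1) with hb
  have hb0 : ∀ t, 0 ≤ b t := fun t => sub_nonneg.2 (remainingMass_antitone k t.le_succ)
  set L : W → ℝ := fun x => Real.log (remainingMass k (lev x) / remainingMass k (lev x + 1))
    with hL
  -- The uncovered mass is at least a sum independent of `S`, which is about `3 / 4`, minus a part
  -- additive over `S`, which is at most `1 / 4`. The term of level `k` is dropped.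
  have h1 : ∑ t ∈ Finset.range k, b t * (remainingMass k (t + 1) *
        (1 - Real.log (remainingMass k (t + 1)))) -
      ∑ t ∈ Finset.range k, b t * remainingMass k (t + 1) * ∑ x ∈ S with lev x ≤ t, L x ≤
      ∑ t ∈ Finset.range (k + 1), b t * ∏ x ∈ S, avoidance k lev O t x := by
    rw [Finset.sum_range_succ, ← Finset.sum_sub_distrib]
    refine le_add_of_le_of_nonneg (Finset.sum_le_sum fun t ht => ?_) (mul_nonneg (hb0 k)
      (Finset.prod_nonneg fun x _ => avoidance_nonneg k x))
    rw [hprod]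
    refine le_trans (le_of_eq ?_) (mul_le_mul_of_nonneg_left
      (prod_remainingMass_div_ge (lev := lev) (Finset.mem_range.1 ht) S) (hb0 t))
    ring
  have h2 : ∑ t ∈ Finset.range k, b t * remainingMass k (t + 1) * ∑ x ∈ S with lev x ≤ t, L x ≤
      1 / 4 := by
    simp only [Finset.sum_filter, Finset.mul_sum]
    rw [Finset.sum_comm]
    -- The number `k - lev x` of levels reached cancels against the decay `1 / (2 * (k - lev x))`,
    -- so no level is a better choice than another.
    have hx : ∀ x ∈ S, ∑ t ∈ Finset.range k, b t * remainingMass k (t + 1) *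
        (if lev x ≤ t then L x else 0) ≤ 1 / (4 * (k + 1)) := by
      intro x _
      by_cases hxk : lev x < k
      · have hxk' : (lev x : ℝ) + 1 ≤ k := by exact_mod_cast hxk
        have hsum : ∑ t ∈ Finset.range k, b t * remainingMass k (t + 1) *
            (if lev x ≤ t then L x else 0) =
            (∑ t ∈ Finset.Ico (lev x) k, b t * remainingMass k (t + 1)) * L x := by
          rw [Finset.sum_mul, ← Finset.sum_range_add_sum_Ico _ hxk.le, Finset.sum_eq_zero, zero_add]
          · refine Finset.sum_congr rfl fun t ht => ?_
            rw [if_pos (Finset.mem_Ico.1 ht).1]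
          · intro t ht
            rw [if_neg (by simpa using ht), mul_zero]
        have hG : ∑ t ∈ Finset.Ico (lev x) k, b t * remainingMass k (t + 1) ≤
            (k - lev x) * (1 / (2 * (k + 1))) := by
          refine (Finset.sum_le_sum fun t ht => remainingMass_mul_sub_le
            (Finset.mem_Ico.1 ht).2.le).trans (le_of_eq ?_)
          rw [Finset.sum_const, Nat.card_Ico, nsmul_eq_mul, Nat.cast_sub hxk.le]
        have hLx : L x ≤ 1 / (2 * (k - lev x)) := log_remainingMass_div_le hxk
        have hG0 : 0 ≤ ∑ t ∈ Finset.Ico (lev x) k, b t * remainingMass k (t + 1) :=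
          Finset.sum_nonneg fun t _ => mul_nonneg (hb0 t) (remainingMass_nonneg _ _)
        have hpos : (0 : ℝ) < k - lev x := by linarith
        calc _ = _ := hsum
          _ ≤ (∑ t ∈ Finset.Ico (lev x) k, b t * remainingMass k (t + 1)) *
              (1 / (2 * (k - lev x))) := by gcongr
          _ ≤ ((k - lev x) * (1 / (2 * (k + 1)))) * (1 / (2 * (k - lev x))) := by gcongr
          _ = _ := by field_simp; norm_num
      · rw [Finset.sum_eq_zero]
        · positivity
        · intro t ht
          have := Finset.mem_range.1 ht
          rw [if_neg (by omega), mul_zero]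
    refine (Finset.sum_le_card_nsmul _ _ _ hx).trans ?_
    have hS' : (S.card : ℝ) ≤ k := by exact_mod_cast hS
    rw [nsmul_eq_mul, mul_one_div, div_le_div_iff₀ (by positivity) (by positivity)]
    linarith
  have h3 := sum_remainingMass_mul_log_ge k
  rw [chainObjective_eq]
  linarith

end

/-! ### The adversarial stream and the elements that the memory certifies. -/

theorem card_toFinset_bitStrings_le (B : ℕ) :
    (List.finite_length_le Bool B).toFinset.card ≤ 2 ^ (B + 1) := by
  have hsub : (List.finite_length_le Bool B).toFinset ⊆ (Finset.range (B + 1)).biUnion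
      fun n => Finset.univ.image (List.ofFn : (Fin n → Bool) → List Bool) := by
    intro l hl
    have hl : l.length ≤ B := (List.finite_length_le Bool B).mem_toFinset.1 hl
    exact Finset.mem_biUnion.2 ⟨l.length, Finset.mem_range.2 (by omega),
      Finset.mem_image.2 ⟨l.get, Finset.mem_univ _, List.ofFn_get l⟩⟩
  have hsum : ∀ N : ℕ, ∑ n ∈ Finset.range N, 2 ^ n ≤ 2 ^ N := by
    intro N
    induction N with
    | zero => simp
    | succ N ih => rw [Finset.sum_range_succ, pow_succ]; omega
  refine (Finset.card_le_card hsub).trans (Finset.card_biUnion_le.trans ?_)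
  refine (Finset.sum_le_sum fun n _ => ?_).trans (hsum (B + 1))
  simpa using Finset.card_image_le (s := (Finset.univ : Finset (Fin n → Bool))) (f := List.ofFn)

namespace StreamAlgorithm

variable {W : Type*}

/-- The memory states from which it follows that `o` has arrived, among the streams of `l` distinct
elements satisfying `Q`. -/
def certainStates (A : StreamAlgorithm W) (f : Finset W → ℝ) (Q : W → Prop) (l : ℕ) (o : W) :
    Set (List Bool) :=
  {m | ∀ ys : List W, ys.Nodup → ys.length = l → (∀ y ∈ ys, Q y) →
    m ∈ (A.stateDist f ys).support → o ∈ ys}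

/-- If some `ys` without `o` could explain the state before `zs`, then `ys ++ zs` explains the state
after it. So later arrivals do not make `o` more certain. -/
theorem certainStates_append_le (A : StreamAlgorithm W) (f : Finset W → ℝ) {Q Q' : W → Prop}
    (hQ : ∀ x, Q x → Q' x) (xs zs : List W) (hzs : zs.Nodup) (hzQ : ∀ z ∈ zs, ¬ Q z ∧ Q' z) {o : W}
    (ho : o ∉ zs) :
    (A.stateDist f (xs ++ zs)).toOuterMeasure (A.certainStates f Q' (xs ++ zs).length o) ≤
      (A.stateDist f xs).toOuterMeasure (A.certainStates f Q xs.length o) := by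
  rw [stateDist_append]
  refine PMF.toOuterMeasure_bind_le _ _ _ _ fun m _ m' hm' hc ys hys hlen hysQ hmy => ?_
  have h := hc (ys ++ zs) (List.nodup_append'.2 ⟨hys, hzs, fun y hy hz =>
    (hzQ y hz).1 (hysQ y hy)⟩) (by simp [hlen]) (by
      intro y hy
      rcases List.mem_append.1 hy with h | h
      · exact hQ y (hysQ y h)
      · exact (hzQ y h).2) (by
      rw [stateDist_append, PMF.mem_support_bind_iff]
      exact ⟨m, hmy, hm'⟩)
  exact (List.mem_append.1 h).resolve_right ho

theorem IsMaxCardStreamAlgorithm.certainStates_congr [Fintype W] [DecidableEq W]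
    {A : StreamAlgorithm W} {k s : ℕ} {ρ : ℝ} (hA : A.IsMaxCardStreamAlgorithm k s ρ)
    {f g : Finset W → ℝ} (hf : IsSubmodularObjective f) (hg : IsSubmodularObjective g)
    {Q : W → Prop} (hfg : ∀ S : Finset W, (∀ x ∈ S, Q x) → f S = g S) {l : ℕ} (hl : l ≤ s) (o : W) :
    A.certainStates f Q l o = A.certainStates g Q l o := by
  ext m
  refine forall_congr' fun ys => forall_congr' fun h1 => forall_congr' fun h2 =>
    forall_congr' fun h3 => ?_
  rw [hA.stateDist_congr hf hg ys h1 (h2.le.trans hl) fun S hS => hfg S fun x hx =>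
    h3 x (List.mem_toFinset.1 (hS hx))]

section
variable [Fintype W] [DecidableEq W] {A : StreamAlgorithm W} {k s : ℕ} {ρ : ℝ}

/-- An adversarial stream: level by level, a block and a hidden element of it are chosen such that
the algorithm is unlikely to know that the hidden element has arrived. -/
theorem IsMaxCardStreamAlgorithm.exists_hidden (hA : A.IsMaxCardStreamAlgorithm k s ρ)
    {B : ℕ} (hB : A.UsesMemoryAtMost s B) (lev : W → ℕ) {X : Type*} [Fintype X] [Nonempty X]
    {n d : ℕ} (hn : 0 < n) (D : List W) (hD : D.Nodup) (hDlev : ∀ x ∈ D, lev x = k + 1)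
    (hs : D.length + k * n ≤ s) (blk : ℕ → X → List W) (hblk : ∀ i < k, ∀ x, (blk i x).Nodup)
    (hlen : ∀ i < k, ∀ x, (blk i x).length = n) (hlev : ∀ i < k, ∀ x, ∀ w ∈ blk i x, lev w = i)
    (hsub : ∀ i < k, ∀ C : Finset W,
      ((Finset.univ.filter fun x => C ⊆ (blk i x).toFinset).card : ℝ) * 2 ^ C.card ≤
        Fintype.card X)
    (i : ℕ) (hi : i ≤ k) :
    ∃ (xs : List W) (O : Finset W), xs.Nodup ∧ xs.length = D.length + i * n ∧
      (∀ x ∈ xs, lev x < i ∨ lev x = k + 1) ∧ (∀ o ∈ O, o ∈ xs ∧ lev o < i) ∧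
      Set.InjOn lev O ∧ (∀ t < i, ∃ o ∈ O, lev o = t) ∧
      ∀ o ∈ O, (A.stateDist (chainObjective k lev O) xs).toOuterMeasure
        (A.certainStates (chainObjective k lev O) (fun x => lev x < i ∨ lev x = k + 1) xs.length o) ≤
        ENNReal.ofReal (d / n + 2 ^ (B + 1) / 2 ^ d) := by
  induction i with
  | zero =>
    exact ⟨D, ∅, hD, by simp, fun x hx => Or.inr (hDlev x hx), by simp, by simp, by simp, by simp⟩
  | succ i ih =>
    obtain ⟨xs, O, h1, h2, h3, h4, h5, h6, h7⟩ := ih (by omega)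
    have hik : i < k := by omega
    -- In `f` nothing of level `i` is hidden, so one fixed objective serves all candidate blocks;
    -- the hidden element of the block is chosen afterwards.
    set f := chainObjective k lev O with hf
    have hfs : IsSubmodularObjective f := isSubmodularObjective_chainObjective
    have hnd : ∀ x, (xs ++ blk i x).Nodup := fun x => List.nodup_append'.2 ⟨h1, hblk i hik x,
      fun y hy hz => by
        have := h3 y hy
        have := hlev i hik x y hz
        omega⟩
    have hlen' : ∀ x, (xs ++ blk i x).length = D.length + (i + 1) * n := fun x => by
      rw [List.length_append, h2, hlen i hik]; ring
    have hle : D.length + (i + 1) * n ≤ s :=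
      le_trans (Nat.add_le_add_left (Nat.mul_le_mul_right n hi) _) hs
    have hlev' : ∀ x, ∀ y ∈ xs ++ blk i x, lev y < i + 1 ∨ lev y = k + 1 := fun x y hy => by
      rcases List.mem_append.1 hy with h | h
      · have := h3 y h
        omega
      · have := hlev i hik x y h
        omega
    have hfin := List.finite_length_le Bool B
    have hcard : (hfin.toFinset.card : ℝ) ≤ 2 ^ (B + 1) := by
      exact_mod_cast card_toFinset_bitStrings_le B
    obtain ⟨x, o, hox, ho⟩ := exists_mem_unlikely_certain hn (fun x => (blk i x).toFinset)
      (fun x => by rw [List.toFinset_card_of_nodup (hblk i hik x), hlen i hik]) (hsub i hik)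
      (fun x => A.stateDist f (xs ++ blk i x)) hfin.toFinset
      (fun x m hm => hfin.mem_toFinset.2
        (hB f hfs (xs ++ blk i x) (hnd x) ((hlen' x).le.trans hle) m hm)) (d := d)
    have hox : o ∈ blk i x := List.mem_toFinset.1 hox
    have hoi := hlev i hik x o hox
    have hoO : o ∉ O := fun h => by have := (h4 o h).2; omega
    set O' := insert o O with hO'
    have hO'lev : ∀ y ∈ O', lev y < i + 1 := by
      intro y hy
      rcases Finset.mem_insert.1 hy with rfl | h
      · omega
      · have := (h4 y h).2
        omega
    have hinj : Set.InjOn lev O' := by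
      rw [hO', Finset.coe_insert, Set.injOn_insert (by simpa using hoO)]
      refine ⟨h5, ?_⟩
      rintro ⟨y, hy, hyo⟩
      have := (h4 y hy).2
      omega
    have hfilter : O'.filter (fun y => lev y < i) = O := by
      ext y
      simp only [hO', Finset.mem_filter, Finset.mem_insert]
      constructor
      · rintro ⟨rfl | h, h'⟩
        · omega
        · exact h
      · exact fun h => ⟨Or.inr h, (h4 y h).2⟩
    -- Hiding `o` changes no value on sets of elements arrived so far, nor on those of competing
    -- streams. Hence state distributions and certified states carry over to the new objective.
    have hagree : ∀ S : Finset W, (∀ y ∈ S, lev y < i + 1 ∨ lev y = k + 1) →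
        f S = chainObjective k lev O' S := by
      intro S hS
      rw [hf, ← hfilter]
      exact chainObjective_filter_lt hinj (fun y hy => (hO'lev y hy).trans_le hi) hik
        fun y hy => (hS y hy).imp_left Nat.le_of_lt_succ
    refine ⟨xs ++ blk i x, O', hnd x, hlen' x, hlev' x, ?_, hinj, ?_, ?_⟩
    · intro y hy
      refine ⟨?_, hO'lev y hy⟩
      rcases Finset.mem_insert.1 hy with rfl | h
      · exact List.mem_append_right _ hox
      · exact List.mem_append_left _ (h4 y h).1
    · intro t ht
      rcases (Nat.le_of_lt_succ ht).eq_or_lt with rfl | h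
      · exact ⟨o, Finset.mem_insert_self _ _, hoi⟩
      · obtain ⟨y, hy, hyt⟩ := h6 t h
        exact ⟨y, Finset.mem_insert_of_mem hy, hyt⟩
    · intro y hy
      have hg : IsSubmodularObjective (chainObjective k lev O') :=
        isSubmodularObjective_chainObjective
      rw [← hA.certainStates_congr hfs hg hagree ((hlen' x).le.trans hle) y,
        ← hA.stateDist_congr hfs hg _ (hnd x) ((hlen' x).le.trans hle) fun S hS =>
          hagree S fun z hz => hlev' x z (List.mem_toFinset.1 (hS hz))]
      rcases Finset.mem_insert.1 hy with rfl | h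
      · refine le_trans ((A.stateDist f (xs ++ blk i x)).toOuterMeasure.mono ?_) (ho.trans
          (ENNReal.ofReal_le_ofReal (by gcongr)))
        intro m hm x' hmx'
        have := hm (xs ++ blk i x') (hnd x') (by rw [hlen', hlen']) (hlev' x') hmx'
        rcases List.mem_append.1 this with h | h
        · have := h3 _ h
          omega
        · exact List.mem_toFinset.2 h
      · refine le_trans (A.certainStates_append_le f (fun z hz => ?_) xs _ (hblk i hik x)
          (fun z hz => ?_) fun h' => ?_) (h7 y h)
        · exact hz.imp_left fun h => by omega
        · have := hlev i hik x z hz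
          omega
        · have := hlev i hik x y h'
          have := (h4 y h).2
          omega

/-- The output depends on the stream only through the state, and it must be feasible for every
stream of length `s` that can lead to this state. -/
theorem IsMaxCardStreamAlgorithm.outputDist_mem_le (hA : A.IsMaxCardStreamAlgorithm k s ρ)
    {f : Finset W → ℝ} (hf : IsSubmodularObjective f) (Q : W → Prop) {xs : List W}
    (hs : xs.length = s) (o : W) :
    (A.outputDist f xs).toOuterMeasure {S | o ∈ S} ≤
      (A.stateDist f xs).toOuterMeasure (A.certainStates f Q xs.length o) := by
  refine PMF.toOuterMeasure_bind_le _ _ _ _ fun m _ S hS hoS ys hys hlen _ hmy => ?_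
  have hS' : S ∈ (A.outputDist f ys).support := (PMF.mem_support_bind_iff _ _ _).2 ⟨m, hmy, hS⟩
  exact List.mem_toFinset.1 ((hA.feasible f hf ys hys (hlen.trans hs) S hS').1 hoS)

omit [DecidableEq W] in
theorem sum_outputDist (f : Finset W → ℝ) (xs : List W) :
    ∑ S, (A.outputDist f xs S).toReal = 1 := by
  rw [← ENNReal.toReal_sum fun S _ => (A.outputDist f xs).apply_ne_top S,
    ← tsum_fintype (L := SummationFilter.unconditional _), PMF.tsum_coe, ENNReal.toReal_one]

/-- If hidden elements are unlikely to be output, then the expected value is small. -/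
theorem expectedValue_le_of_hidden {f : Finset W → ℝ} {xs : List W} {O : Finset W} {c β : ℝ}
    (hβ : 0 ≤ β) (hc : 0 ≤ c) (h1 : ∀ S, f S ≤ 1)
    (h2 : ∀ S ∈ (A.outputDist f xs).support, Disjoint S O → f S ≤ c)
    (h3 : ∀ o ∈ O, (A.outputDist f xs).toOuterMeasure {S | o ∈ S} ≤ ENNReal.ofReal β) :
    A.expectedValue f xs ≤ c + O.card * β := by
  set p : Finset W → ℝ := fun S => (A.outputDist f xs S).toReal with hp
  have hp0 : ∀ S, 0 ≤ p S := fun S => ENNReal.toReal_nonneg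
  have hO : ∀ o ∈ O, ∑ S, (if o ∈ S then p S else 0) ≤ β := by
    intro o ho
    have h := h3 o ho
    rw [PMF.toOuterMeasure_apply_fintype] at h
    have h' := ENNReal.toReal_mono ENNReal.ofReal_ne_top h
    rw [ENNReal.toReal_ofReal hβ, ENNReal.toReal_sum] at h'
    · refine le_trans (le_of_eq (Finset.sum_congr rfl fun S _ => ?_)) h'
      by_cases hS : o ∈ S <;> simp [hS, hp]
    · intro S _
      by_cases hS : o ∈ S <;> simp [hS, PMF.apply_ne_top]
  have hS : ∀ S, p S * f S ≤ p S * c + ∑ o ∈ O, if o ∈ S then p S else 0 := by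
    intro S
    have hnn : 0 ≤ ∑ o ∈ O, if o ∈ S then p S else 0 :=
      Finset.sum_nonneg fun o _ => by split_ifs; exacts [hp0 S, le_rfl]
    by_cases hd : Disjoint S O
    · by_cases hmem : S ∈ (A.outputDist f xs).support
      · exact le_add_of_le_of_nonneg (mul_le_mul_of_nonneg_left (h2 S hmem hd) (hp0 S)) hnn
      · have : p S = 0 := by simp [hp, (PMF.apply_eq_zero_iff _ S).2 hmem]
        simp [this]
    · obtain ⟨o, hoS, hoO⟩ := Finset.not_disjoint_iff.1 hd
      have h4 : p S ≤ ∑ o ∈ O, if o ∈ S then p S else 0 := by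
        refine le_trans (le_of_eq ?_) (Finset.single_le_sum (f := fun o => if o ∈ S then p S else 0)
          (fun o _ => ?_) hoO)
        · simp [hoS]
        · split_ifs
          exacts [hp0 S, le_rfl]
      have := mul_le_mul_of_nonneg_left (h1 S) (hp0 S)
      have := mul_nonneg (hp0 S) hc
      linarith
  calc A.expectedValue f xs ≤ ∑ S, (p S * c + ∑ o ∈ O, if o ∈ S then p S else 0) :=
        Finset.sum_le_sum fun S _ => hS S
    _ = c + ∑ o ∈ O, ∑ S, if o ∈ S then p S else 0 := by
        rw [Finset.sum_add_distrib, ← Finset.sum_mul, sum_outputDist, one_mul, Finset.sum_comm]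
    _ ≤ c + O.card * β := by
        rw [← nsmul_eq_mul]
        gcongr
        exact Finset.sum_le_card_nsmul _ _ _ hO

/-- An algorithm whose memory never holds a bit does not know any element that has arrived. -/
theorem IsMaxCardStreamAlgorithm.pos_of_usesMemoryAtMost (hA : A.IsMaxCardStreamAlgorithm k s ρ)
    (hρ : 0 < ρ) (hk : 1 ≤ k) (hs : 1 ≤ s) (hW : 2 * s ≤ Fintype.card W) {B : ℕ}
    (hB : A.UsesMemoryAtMost s B) : 1 ≤ B := by
  by_contra! hB0
  obtain rfl : B = 0 := by omega
  set f : Finset W → ℝ := fun S => S.card with hf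
  have hfs : IsSubmodularObjective f := by
    refine ⟨fun X => by positivity, fun X Y h => by simp only [hf]; gcongr, fun X Y h v hv => ?_⟩
    simp [hf, Finset.card_insert_of_notMem hv, Finset.card_insert_of_notMem fun h' => hv (h h')]
  -- Two disjoint streams lead to the same empty memory. The output is feasible for both, hence
  -- empty, and has value `0` under the cardinality objective.
  obtain ⟨U, -, hU⟩ := Finset.exists_subset_card_eq
    (show s ≤ (Finset.univ : Finset W).card by rw [Finset.card_univ]; omega)
  obtain ⟨U', hUU', hU'⟩ := Finset.exists_subset_card_eq (show s ≤ Uᶜ.card by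
    rw [Finset.card_compl]; omega)
  have hstate : ∀ T : Finset W, T.card = s → A.stateDist f T.toList = PMF.pure [] := by
    intro T hT
    have hsupp : (A.stateDist f T.toList).support ⊆ {[]} := by
      intro m hm
      have := hB f hfs T.toList T.nodup_toList (by rw [Finset.length_toList, hT]) m hm
      simpa using this
    have h1 := ((A.stateDist f T.toList).apply_eq_one_iff []).2
      (hsupp.antisymm (by
        obtain ⟨m, hm⟩ := (A.stateDist f T.toList).support_nonempty
        rintro _ rfl
        have : m = [] := hsupp hm
        exact this ▸ hm))
    ext m
    by_cases hm : m = []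
    · subst hm; simp [h1]
    · have : m ∉ (A.stateDist f T.toList).support := fun h => hm (hsupp h)
      simp [(PMF.apply_eq_zero_iff _ m).2 this, hm]
  have hout : ∀ T : Finset W, T.card = s → A.outputDist f T.toList = A.output f [] := by
    intro T hT
    rw [outputDist, hstate T hT, PMF.pure_bind]
  have hempty : ∀ S ∈ (A.output f []).support, S = ∅ := by
    intro S hS
    have h1 := (hA.feasible f hfs U.toList U.nodup_toList (by simp [hU]) S
      (by rwa [hout U hU])).1
    have h2 := (hA.feasible f hfs U'.toList U'.nodup_toList (by simp [hU']) S
      (by rwa [hout U' hU'])).1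
    rw [Finset.toList_toFinset] at h1 h2
    refine Finset.eq_empty_of_forall_notMem fun x hx => ?_
    exact Finset.mem_compl.1 (hUU' (h2 hx)) (h1 hx)
  obtain ⟨v, hv⟩ := Finset.card_pos.1 (show 0 < U.card by omega)
  have h := hA.approx f hfs U.toList U.nodup_toList (by simp [hU]) {v} (by simpa using hv)
    (by simpa using hk)
  have h0 : A.expectedValue f U.toList = 0 := by
    refine Finset.sum_eq_zero fun S _ => ?_
    rw [hout U hU]
    by_cases hS : S ∈ (A.output f []).support
    · simp [hempty S hS, hf]
    · simp [(PMF.apply_eq_zero_iff _ S).2 hS]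
  rw [h0] at h
  simp only [hf, Finset.card_singleton, Nat.cast_one] at h
  linarith

end

end StreamAlgorithm

/-! ### Blocks as transversals of pairs, and the bound on the ratio. -/

/-- Of the `2 ^ n` transversals of `n` disjoint pairs, at most `2 ^ (n - |C|)` contain `C`. -/
theorem card_transversals_mul_le {W : Type*} [DecidableEq W] {n : ℕ} {v : Fin n × Bool → W}
    (hv : Function.Injective v) (C : Finset W) :
    (Finset.univ.filter fun x : Fin n → Bool =>
      C ⊆ (List.ofFn fun j => v (j, x j)).toFinset).card * 2 ^ C.card ≤ 2 ^ n := by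
  rcases Finset.eq_empty_or_nonempty (Finset.univ.filter fun x : Fin n → Bool =>
      C ⊆ (List.ofFn fun j => v (j, x j)).toFinset) with h | ⟨x₀, hx₀⟩
  · rw [h]; simp
  have hmem : ∀ x : Fin n → Bool, x ∈ (Finset.univ.filter fun x : Fin n → Bool =>
      C ⊆ (List.ofFn fun j => v (j, x j)).toFinset) → ∀ w ∈ C, ∃ j, v (j, x j) = w := by
    intro x hx w hw
    have := List.mem_toFinset.1 ((Finset.mem_filter.1 hx).2 hw)
    simpa [List.mem_ofFn] using this
  set J : Finset (Fin n) := Finset.univ.filter fun j => v (j, x₀ j) ∈ C with hJ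
  have hCJ : C.card ≤ J.card := by
    refine (Finset.card_le_card fun w hw => ?_).trans
      (Finset.card_image_le (s := J) (f := fun j => v (j, x₀ j)))
    obtain ⟨j, hj⟩ := hmem x₀ hx₀ w hw
    exact Finset.mem_image.2 ⟨j, by simp [hJ, hj, hw], hj⟩
  have hsub : (Finset.univ.filter fun x : Fin n → Bool =>
      C ⊆ (List.ofFn fun j => v (j, x j)).toFinset) ⊆
      Fintype.piFinset fun j => if j ∈ J then {x₀ j} else Finset.univ := by
    intro x hx
    refine Fintype.mem_piFinset.2 fun j => ?_
    split_ifs with hj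
    · obtain ⟨j', hj'⟩ := hmem x hx _ (Finset.mem_filter.1 hj).2
      have h := hv hj'
      obtain ⟨rfl, h2⟩ := Prod.mk.inj h
      simpa using h2
    · simp
  calc _ ≤ (∏ j : Fin n, if j ∈ J then 1 else 2) * 2 ^ J.card := by
        refine Nat.mul_le_mul ((Finset.card_le_card hsub).trans (le_of_eq ?_))
          (Nat.pow_le_pow_right (by norm_num) hCJ)
        rw [Fintype.card_piFinset]
        refine Finset.prod_congr rfl fun j _ => ?_
        split_ifs <;> simp
    _ = (∏ j : Fin n, if j ∈ J then 1 else 2) * ∏ j : Fin n, if j ∈ J then 2 else 1 := by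
        rw [Finset.prod_ite_mem, Finset.univ_inter, Finset.prod_const]
    _ = ∏ j : Fin n, 2 := by
        rw [← Finset.prod_mul_distrib]
        refine Finset.prod_congr rfl fun j _ => ?_
        split_ifs <;> rfl
    _ ≤ 2 ^ n := by simp

namespace StreamAlgorithm.IsMaxCardStreamAlgorithm

variable {W : Type*} [Fintype W] [DecidableEq W] {A : StreamAlgorithm W} {k s : ℕ} {ρ : ℝ}

/-- Tested on the objective that is `1` on nonempty sets and `0` on `∅`. -/
theorem ratio_le_one (hA : A.IsMaxCardStreamAlgorithm k s ρ) (hk : 1 ≤ k) (hs : 1 ≤ s)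
    (hW : s ≤ Fintype.card W) : ρ ≤ 1 := by
  have hf := Finset.isSubmodularObjective_coverage (W := W) (Finset.univ : Finset Unit)
    (fun _ => 1) (fun _ _ => 0) (by simp) (by simp) (by simp)
  set f : Finset W → ℝ := fun S => ∑ t : Unit, 1 * (1 - ∏ x ∈ S, 0) with hfd
  obtain ⟨U, -, hU⟩ := Finset.exists_subset_card_eq
    (show s ≤ (Finset.univ : Finset W).card by rwa [Finset.card_univ])
  obtain ⟨v, hv⟩ := Finset.card_pos.1 (show 0 < U.card by omega)
  have h := hA.approx f hf U.toList U.nodup_toList (by simp [hU]) {v} (by simpa using hv)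
    (by simpa using hk)
  have h1 : A.expectedValue f U.toList ≤ ∑ S, (A.outputDist f U.toList S).toReal := by
    refine Finset.sum_le_sum fun S _ => mul_le_of_le_one_right ENNReal.toReal_nonneg ?_
    have : (0 : ℝ) ≤ ∏ x ∈ S, 0 := Finset.prod_nonneg fun _ _ => le_rfl
    simp only [hfd, Finset.sum_const, Finset.card_univ, Fintype.card_unit, one_smul, one_mul]
    linarith
  rw [sum_outputDist] at h1
  have h2 : f {v} = 1 := by simp [hfd]
  rw [h2] at h
  linarith

/-- The approximation guarantee of an algorithm with `B` bits of memory, for streams of `k` blocks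
of `n` elements. -/
theorem ratio_mul_le (hA : A.IsMaxCardStreamAlgorithm k s ρ) (hW : 2 * s ≤ Fintype.card W)
    {B : ℕ} (hB : A.UsesMemoryAtMost s B) {n : ℕ} (d : ℕ) (hn : 0 < n) (hns : k * n ≤ s) :
    ρ * (1 - 1 / √(k + 1 : ℝ)) ≤
      1 / 2 + 1 / √(k + 1 : ℝ) + k * (d / n + 2 ^ (B + 1) / 2 ^ d) := by
  -- `k` blocks of `n` pairs, and padding that brings the stream to length `s`. The padding gets
  -- level `k + 1`, beyond all masses, and so covers nothing.
  obtain ⟨e⟩ : Nonempty ((Fin k × Fin n × Bool) ⊕ Fin (s - k * n) ↪ W) := by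
    refine Function.Embedding.nonempty_of_card_le (le_trans (le_of_eq ?_)
      (show 2 * (k * n) + (s - k * n) ≤ Fintype.card W by omega))
    simp only [Fintype.card_sum, Fintype.card_prod, Fintype.card_fin, Fintype.card_bool]
    ring
  classical
  set lev : W → ℕ := fun w =>
    if h : ∃ t : Fin k × Fin n × Bool, e (Sum.inl t) = w then (h.choose.1 : ℕ) else k + 1 with hlevd
  have hlev : ∀ t, lev (e (Sum.inl t)) = t.1 := by
    intro t
    have h : ∃ t' : Fin k × Fin n × Bool, e (Sum.inl t') = e (Sum.inl t) := ⟨t, rfl⟩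
    have h' : h.choose = t := Sum.inl_injective (e.injective h.choose_spec)
    simp only [hlevd]
    rw [dif_pos h, h']
  have hlevr : ∀ j, lev (e (Sum.inr j)) = k + 1 := by
    intro j
    refine dif_neg ?_
    rintro ⟨t, ht⟩
    exact Sum.inl_ne_inr (e.injective ht)
  set blk : ℕ → (Fin n → Bool) → List W := fun i x =>
    if h : i < k then List.ofFn fun j => e (Sum.inl (⟨i, h⟩, j, x j)) else [] with hblk
  have hblk' : ∀ i (h : i < k), ∀ x, blk i x = List.ofFn fun j => e (Sum.inl (⟨i, h⟩, j, x j)) :=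
    fun i h x => dif_pos h
  have hinj : ∀ i (h : i < k), Function.Injective fun p : Fin n × Bool =>
      e (Sum.inl (⟨i, h⟩, p)) := fun i h p q hpq => by
    simpa using hpq
  set D : List W := List.ofFn fun j : Fin (s - k * n) => e (Sum.inr j) with hD
  obtain ⟨xs, O, h1, h2, -, h4, h5, h6, h7⟩ := hA.exists_hidden hB lev (n := n) (d := d) hn D
    (List.nodup_ofFn.2 fun i j hij => by simpa using hij)
    (fun x hx => by
      obtain ⟨j, rfl⟩ := (List.mem_ofFn' _ _).1 hx
      exact hlevr j)
    (by simp only [hD, List.length_ofFn]; omega) blk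
    (fun i hi x => by
      rw [hblk' i hi]
      refine List.nodup_ofFn.2 fun a b hab => ?_
      exact (Prod.mk.inj (hinj i hi hab)).1)
    (fun i hi x => by rw [hblk' i hi, List.length_ofFn])
    (fun i hi x w hw => by
      rw [hblk' i hi] at hw
      obtain ⟨j, rfl⟩ := (List.mem_ofFn' _ _).1 hw
      exact hlev _)
    (fun i hi C => by
      have := card_transversals_mul_le (hinj i hi) C
      simp only [hblk' i hi, Fintype.card_fun, Fintype.card_bool, Fintype.card_fin]
      exact_mod_cast this)
    k le_rfl
  have hlen : xs.length = s := by
    rw [h2, hD, List.length_ofFn]; omega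
  have hO : O.card = k := by
    have himg : O.image lev = Finset.range k := by
      ext t
      simp only [Finset.mem_image, Finset.mem_range]
      exact ⟨fun ⟨o, ho, hot⟩ => hot ▸ (h4 o ho).2, fun ht => h6 t ht⟩
    rw [← Finset.card_image_of_injOn h5, himg, Finset.card_range]
  have hf : IsSubmodularObjective (chainObjective k lev O) := isSubmodularObjective_chainObjective
  have happ := hA.approx _ hf xs h1 hlen O (fun o ho => List.mem_toFinset.2 (h4 o ho).1) hO.le
  rw [chainObjective_hidden h6 fun o ho => (h4 o ho).2] at happ
  refine happ.trans ((expectedValue_le_of_hidden (A := A) (O := O) (c := 1 / 2 + 1 / √(k + 1 : ℝ))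
    (β := d / n + 2 ^ (B + 1) / 2 ^ d) (by positivity) (by positivity) chainObjective_le_one
    (fun S hS hd => ?_) fun o ho => ?_).trans (by rw [hO]))
  · exact chainObjective_le_of_disjoint (hA.feasible _ hf xs h1 hlen S hS).2 hd
  · exact (hA.outputDist_mem_le hf _ hlen o).trans (h7 o ho)

end StreamAlgorithm.IsMaxCardStreamAlgorithm

/-! ### Choice of the parameters. -/

theorem mainTheorem2 :
    ∃ c : ℝ, 0 < c ∧ ∀ ε : ℝ, 0 < ε → ∃ k₀ : ℕ, ∀ k : ℕ, k₀ ≤ k →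
      ∀ (s : ℕ) (W : Type) [Fintype W] [DecidableEq W], 2 * s ≤ Fintype.card W →
      ∀ A : StreamAlgorithm W, A.IsMaxCardStreamAlgorithm k s (1 / 2 + ε) →
      ∀ B : ℕ, A.UsesMemoryAtMost s B → c * ε * s / (k : ℝ) ^ 3 ≤ B := by
  -- The term `64 / ε ^ 2` gives `1 / √(k + 1) ≤ ε / 8`, and `1 / ε` gives `1 ≤ k * ε`, used to
  -- absorb `ε` into powers of `k`.
  refine ⟨1 / 64, by norm_num, fun ε hε => ⟨⌈64 + 64 / ε ^ 2 + 1 / ε⌉₊, ?_⟩⟩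
  intro k hk s W _ _ hW A hA B hB
  have hk' : 64 + 64 / ε ^ 2 + 1 / ε ≤ k := (Nat.le_ceil _).trans (by exact_mod_cast hk)
  have hp1 : 0 < 64 / ε ^ 2 := by positivity
  have hp2 : 0 < 1 / ε := by positivity
  have hk64 : (64 : ℝ) ≤ k := by linarith
  have hk0 : (0 : ℝ) < k := by linarith
  have hk1 : 1 ≤ k := by
    have : (1 : ℝ) ≤ k := by linarith
    exact_mod_cast this
  by_contra! hcon
  have hs : 1 ≤ s := by
    by_contra! h
    obtain rfl : s = 0 := by omega
    have : (0 : ℝ) ≤ B := by positivity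
    simp at hcon
    linarith
  have hB1 : (1 : ℝ) ≤ B := by
    exact_mod_cast hA.pos_of_usesMemoryAtMost (by linarith) hk1 hs hW hB
  have hε1 : ε ≤ 1 / 2 := by
    have := hA.ratio_le_one hk1 hs (by omega)
    linarith
  have hkε : 1 ≤ k * ε := by
    have : 1 / ε ≤ k := by linarith
    rwa [div_le_iff₀ hε] at this
  have hkε2 : 64 ≤ k * ε ^ 2 := by
    have : 64 / ε ^ 2 ≤ k := by linarith
    rwa [div_le_iff₀ (by positivity)] at this
  -- Since `1 ≤ B`, the assumed failure of the bound forces `s` to be large. The third factor `k` is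
  -- spent here: it yields `8 * k ≤ X` below.
  have hεs : 64 * (k : ℝ) ^ 3 < ε * s := by
    have := hB1.trans_lt hcon
    rw [lt_div_iff₀ (by positivity)] at this
    linarith
  have hs2k : 2 * (k : ℝ) ≤ s := by
    have h1 : ε * s ≤ 1 / 2 * s := by gcongr
    have h2 : (k : ℝ) ≤ k ^ 3 := le_self_pow₀ (by linarith) (by norm_num)
    linarith
  set n := s / k with hn
  have hnR : (s : ℝ) / (2 * k) ≤ n := by
    have h1 : (s : ℝ) < k * (n + 1) := by
      exact_mod_cast Nat.lt_mul_div_succ s (show 0 < k by omega)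
    rw [div_le_iff₀ (by positivity)]
    nlinarith
  have hn0 : (0 : ℝ) < n := lt_of_lt_of_le (div_pos (by linarith) (by positivity)) hnR
  -- With `d = ⌊X⌋₊` the term `d / n` is at most `ε / (4 * k)`. The surplus `4 * k` of `d` over `B +
  -- 1` does the same for `2 ^ (B + 1) / 2 ^ d`, so the `k` hidden elements together gain at most `ε
  -- / 2`.
  set X : ℝ := ε * n / (4 * k) with hX
  have hXs : ε * s / (8 * k ^ 2) ≤ X := by
    calc ε * s / (8 * k ^ 2) = ε * (s / (2 * k)) / (4 * k) := by field_simp; norm_num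
      _ ≤ X := by rw [hX]; gcongr
  have hX8 : 8 * (k : ℝ) ≤ X := by
    refine le_trans ?_ hXs
    rw [le_div_iff₀ (by positivity)]
    linarith
  have hBX : (B : ℝ) ≤ X / 8 := by
    refine hcon.le.trans ?_
    calc 1 / 64 * ε * s / (k : ℝ) ^ 3 = (ε * s / (8 * k ^ 2)) / (8 * k) := by field_simp; norm_num
      _ ≤ X / (8 * k) := by gcongr
      _ ≤ X / 8 := by gcongr; linarith
  set d := ⌊X⌋₊ with hd
  have hX0 : 0 ≤ X := by linarith
  have hdX : (d : ℝ) ≤ X := Nat.floor_le hX0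
  have hdX' : X < d + 1 := Nat.lt_floor_add_one X
  have hdn : (d : ℝ) / n ≤ ε / (4 * k) := by
    rw [div_le_iff₀ hn0]
    exact hdX.trans (le_of_eq (by rw [hX]; ring))
  have hBd : B + 1 + 4 * k ≤ d := by
    have : (B : ℝ) + 1 + 4 * k ≤ d := by linarith
    exact_mod_cast this
  have hpow : (2 : ℝ) ^ (B + 1) / 2 ^ d ≤ ε / (4 * k) := by
    have h1 : (2 : ℝ) ^ (B + 1) * 2 ^ (4 * k) ≤ 2 ^ d := by
      rw [← pow_add]
      exact pow_le_pow_right₀ (by norm_num) hBd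
    have h2 : (k : ℝ) ^ 4 ≤ 2 ^ (4 * k) := by
      rw [mul_comm, pow_mul]
      have : (k : ℝ) ≤ 2 ^ k := by exact_mod_cast Nat.lt_two_pow_self.le
      gcongr
    have h3 : 4 * (k : ℝ) ≤ ε * 2 ^ (4 * k) := by
      have h4 : 4 ≤ (k : ℝ) ^ 2 := by nlinarith
      calc 4 * (k : ℝ) ≤ k ^ 2 * (k * (k * ε)) := by
            have : (k : ℝ) ≤ k * (k * ε) := le_mul_of_one_le_right hk0.le hkε
            nlinarith
        _ = ε * k ^ 4 := by ring
        _ ≤ _ := by gcongr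
    rw [div_le_div_iff₀ (by positivity) (by positivity)]
    calc (2 : ℝ) ^ (B + 1) * (4 * k) ≤ 2 ^ (B + 1) * (ε * 2 ^ (4 * k)) := by gcongr
      _ = ε * (2 ^ (B + 1) * 2 ^ (4 * k)) := by ring
      _ ≤ ε * 2 ^ d := by gcongr
  have hβ : (k : ℝ) * (d / n + 2 ^ (B + 1) / 2 ^ d) ≤ ε / 2 := by
    calc _ ≤ (k : ℝ) * (ε / (4 * k) + ε / (4 * k)) := by gcongr
      _ = ε / 2 := by field_simp; norm_num
  have hmain := hA.ratio_mul_le hW hB d (by exact_mod_cast hn0) (Nat.mul_div_le s k)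
  have hr1 : 1 / √(k + 1 : ℝ) ≤ ε / 8 := by
    rw [div_le_iff₀ (by positivity)]
    have : 8 / ε ≤ √(k + 1 : ℝ) := by
      refine Real.le_sqrt_of_sq_le ?_
      rw [div_pow]
      linarith
    rw [div_le_iff₀ hε] at this
    linarith
  have hr0 : 0 ≤ 1 / √(k + 1 : ℝ) := by positivity
  nlinarith
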